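/- Let $\xi_1,\xi_2,\dots$ be independent random variables, each uniform on $\{-1,+1\}$, let $S_i=\sum_{j=1}^{i}\xi_j$ be the simple symmetric random walk started at $0$, and let $L_n=\sum_{i=1}^{n}S_i^2/i^2$. Then for every fixed $c\in(0,1)$, $$\Pr[L_n\le c\ln n]=e^{-(K(c)+o(1))\ln n}\qquad\text{as } n\to\infty,\qquad\text{where } K(c)=\frac{(1-c)^2}{8c}.$$ That is, there is a sequence $\varepsilon_n\to0$ (which may depend on $c$) such that $\Pr[L_n\le c\ln n]=e^{-(K(c)+\varepsilon_n)\ln n}$ for all sufficiently large $n$. -/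

import Mathlib

open MeasureTheory ProbabilityTheory Filter Topology

namespace SimpleWalk

/-- The random variables `ξ 0, ξ 1, …` are independent and uniform on `{1, -1}`. They are the
steps of the walk; `ξ i` is the step taken at time `i + 1`. -/
structure IsFairSigns {Ω : Type*} [MeasurableSpace Ω] (μ : Measure Ω) (ξ : ℕ → Ω → ℝ) :
    Prop where
  measurable : ∀ i, Measurable (ξ i)
  indep : iIndepFun ξ μ
  prob_one : ∀ i, μ {ω | ξ i ω = 1} = 1 / 2
  prob_neg_one : ∀ i, μ {ω | ξ i ω = -1} = 1 / 2

/-- The position `S_t` of the walk at time `t`, the sum of its first `t` steps (so `S_0 = 0`). -/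
def walk {Ω : Type*} (ξ : ℕ → Ω → ℝ) (t : ℕ) (ω : Ω) : ℝ :=
  ∑ i ∈ Finset.range t, ξ i ω

/-- The quadratic functional `L_n = ∑_{i=1}^n S_i² / i²`. -/
noncomputable def quadFunctional {Ω : Type*} (ξ : ℕ → Ω → ℝ) (n : ℕ) (ω : Ω) : ℝ :=
  ∑ i ∈ Finset.Icc 1 n, walk ξ i ω ^ 2 / (i : ℝ) ^ 2

/-- The rate function `K(c) = (1 - c)² / (8c)`. -/
noncomputable def rate (c : ℝ) : ℝ :=
  (1 - c) ^ 2 / (8 * c)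

end SimpleWalk

/-! Everything rests on the estimate E exp(-θ L_n) = n^(-β + o(1)) for θ = 2β² + β, β > 0. To obtain
it, weight exp(-θ L_k) by a Gaussian factor exp(-g S_{k+1}²). Averaging over the last step of the
walk costs a factor e^(-g) and replaces g by about g - 2g², so the recursion closes if g_k ≈ θ/k² +
g_{k+1} - 2g_{k+1}². This discrete Riccati equation is solved to leading order by g_k = β/k, and the
accumulated cost is exp(-β ∑ 1/k) ≈ n^(-β). `integral_exp_le` and `exists_le_integral_exp` make this
rigorous with perturbed weights.

The upper bound on the probability is Chernoff's inequality at the optimal β = (1-c)/(4c), where β -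
θc = K(c). The lower bound is a Gärtner–Ellis argument: since dβ/dθ = 1/(1+4β), the measure tilted
by exp(-θ L_n) concentrates L_n near log n/(1+4β). The moments at two nearby parameters show that
the rest of the tilted mass is negligible, and undoing the tilt on the remaining window gives the
bound. -/

namespace SimpleWalk

/-! ### One-step averages of Gaussian weights and discrete Riccati inequalities. -/

section Inequalities

/-- With y = x²/2, cosh x ≥ 1 + y and log(1 + y) ≥ 2y/(y + 2) ≥ y - y²/2. -/
lemma exp_sub_le_cosh (x : ℝ) : Real.exp (x ^ 2 / 2 - x ^ 4 / 8) ≤ Real.cosh x := by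
  have hy : (0 : ℝ) ≤ x ^ 2 / 2 := by positivity
  have hc : 1 + x ^ 2 / 2 ≤ Real.cosh x := by
    have h1 : Real.cosh x = 1 + 2 * Real.sinh (x / 2) ^ 2 := by
      have h := Real.cosh_two_mul (x / 2)
      rw [Real.cosh_sq, mul_div_cancel₀ x two_ne_zero] at h
      linarith
    have h2 : (x / 2) ^ 2 ≤ Real.sinh (x / 2) ^ 2 := by
      rw [sq_le_sq, Real.abs_sinh]
      exact Real.self_le_sinh_iff.2 (abs_nonneg _)
    rw [h1]
    linarith
  refine le_trans ?_ hc
  rw [← Real.le_log_iff_exp_le (by positivity)]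
  refine le_trans ?_ (Real.le_log_one_add_of_nonneg hy)
  rw [le_div_iff₀ (by positivity)]
  nlinarith [mul_nonneg hy (mul_nonneg hy hy)]

lemma exp_average_le (g s : ℝ) :
    (Real.exp (-g * (s + 1) ^ 2) + Real.exp (-g * (s - 1) ^ 2)) / 2 ≤
      Real.exp (-g) * Real.exp (-(g - 2 * g ^ 2) * s ^ 2) := by
  have h : (Real.exp (-g * (s + 1) ^ 2) + Real.exp (-g * (s - 1) ^ 2)) / 2 =
      Real.exp (-g * (s ^ 2 + 1)) * Real.cosh (2 * g * s) := by
    rw [Real.cosh_eq, mul_div_assoc', mul_add, ← Real.exp_add, ← Real.exp_add, add_comm]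
    ring_nf
  rw [h]
  refine (mul_le_mul_of_nonneg_left (Real.cosh_le_exp_half_sq _) (Real.exp_pos _).le).trans
    (le_of_eq ?_)
  rw [← Real.exp_add, ← Real.exp_add]
  ring_nf

/-- The error x⁴/8 in the lower bound for cosh produces an s⁴ term, so a quartic weight d must be
carried along. Its cross term has the same sign as that of g, so dropping it only decreases cosh. -/
lemma le_exp_average {g d : ℝ} (hg : 0 ≤ g) (hd : 0 ≤ d) (s : ℝ) :
    Real.exp (-(g + d)) *
        Real.exp (-(g + 6 * d - 2 * g ^ 2) * s ^ 2 - (d + 2 * g ^ 4) * s ^ 4) ≤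
      (Real.exp (-g * (s + 1) ^ 2 - d * (s + 1) ^ 4) +
        Real.exp (-g * (s - 1) ^ 2 - d * (s - 1) ^ 4)) / 2 := by
  have h : (Real.exp (-g * (s + 1) ^ 2 - d * (s + 1) ^ 4) +
        Real.exp (-g * (s - 1) ^ 2 - d * (s - 1) ^ 4)) / 2 =
      Real.exp (-g * (s ^ 2 + 1) - d * (s ^ 4 + 6 * s ^ 2 + 1)) *
        Real.cosh (2 * g * s + 4 * d * (s ^ 2 + 1) * s) := by
    rw [Real.cosh_eq, mul_div_assoc', mul_add, ← Real.exp_add, ← Real.exp_add, add_comm]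
    ring_nf
  have hc : Real.cosh (2 * g * s) ≤ Real.cosh (2 * g * s + 4 * d * (s ^ 2 + 1) * s) := by
    rw [Real.cosh_le_cosh, ← add_mul, abs_mul (2 * g) s, abs_mul (2 * g + _) s]
    refine mul_le_mul_of_nonneg_right ?_ (abs_nonneg s)
    have : 0 ≤ 4 * d * (s ^ 2 + 1) := by positivity
    rw [abs_of_nonneg (by positivity), abs_of_nonneg (by positivity)]
    linarith
  rw [h]
  refine le_trans (le_of_eq ?_) (mul_le_mul_of_nonneg_left
    ((exp_sub_le_cosh _).trans hc) (Real.exp_pos _).le)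
  rw [← Real.exp_add, ← Real.exp_add]
  ring_nf

lemma log_succ_sub_log_le {x : ℝ} (hx : 0 < x) : Real.log (x + 1) - Real.log x ≤ 1 / x := by
  rw [← Real.log_div (by positivity) hx.ne']
  refine (Real.log_le_sub_one_of_pos (by positivity)).trans (le_of_eq ?_)
  field_simp
  ring

lemma le_log_succ_sub_log {x : ℝ} (hx : 0 < x) :
    1 / (x + 1) ≤ Real.log (x + 1) - Real.log x := by
  have h := Real.log_le_sub_one_of_pos (show 0 < x / (x + 1) by positivity)
  rw [Real.log_div hx.ne' (by positivity)] at h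
  have : x / (x + 1) - 1 = -(1 / (x + 1)) := by field_simp; ring
  linarith

/-- The weights `β (1 / x - 1 / N)` satisfy the discrete Riccati inequality. -/
lemma riccati_le {β x N : ℝ} (hβ : 0 ≤ β) (hx : 0 < x) (hN : x + 1 ≤ N) :
    β * (1 / x - 1 / N) ≤ (2 * β ^ 2 + β) / x ^ 2 + (β * (1 / (x + 1) - 1 / N) -
      2 * (β * (1 / (x + 1) - 1 / N)) ^ 2) := by
  have hN0 : 0 < N := by linarith
  have h1 : 1 / N ≤ 1 / (x + 1) := one_div_le_one_div_of_le (by linarith) hN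
  have h2 : 1 / (x + 1) ≤ 1 / x := one_div_le_one_div_of_le hx (by linarith)
  have h3 : 0 < 1 / N := by positivity
  -- Subtracting 1/N leaves differences of weights unchanged and only shrinks the square.
  have h4 : (1 / (x + 1) - 1 / N) ^ 2 ≤ (1 / x) ^ 2 :=
    pow_le_pow_left₀ (by linarith) (by linarith) 2
  have h5 : 1 / x - 1 / (x + 1) ≤ (1 / x) ^ 2 := by
    have : 1 / x - 1 / (x + 1) = 1 / x * (1 / (x + 1)) := by field_simp; ring
    rw [this, sq]
    exact mul_le_mul_of_nonneg_left h2 (by positivity)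
  have h6 : (2 * β ^ 2 + β) / x ^ 2 = (2 * β ^ 2 + β) * (1 / x) ^ 2 := by field_simp
  rw [h6]
  nlinarith [mul_le_mul_of_nonneg_left h5 hβ, mul_le_mul_of_nonneg_left h4 (sq_nonneg β)]

/-- The weights `β / x` and `β ^ 4 / x ^ 3` satisfy the reverse discrete Riccati inequality, once
`x` is large. -/
lemma le_riccati {β θ x : ℝ} (hβ : 0 ≤ β) (hx : 0 < x) (hθ : θ < 2 * β ^ 2 + β)
    (hxl : (2 * (2 * β ^ 2 + β) + 6 * β ^ 4) / (2 * β ^ 2 + β - θ) ≤ x) :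
    θ / x ^ 2 + (β / (x + 1) + 6 * (β ^ 4 / (x + 1) ^ 3) - 2 * (β / (x + 1)) ^ 2) ≤ β / x := by
  have hs : 0 ≤ 2 * β ^ 2 + β := by positivity
  rw [div_le_iff₀ (by linarith)] at hxl
  have h1 : (1 - 2 / x) / x ^ 2 ≤ 1 / (x + 1) ^ 2 := by
    rw [div_le_div_iff₀ (by positivity) (by positivity)]
    have : (1 - 2 / x) * (x + 1) ^ 2 = x ^ 2 - 3 - 2 / x := by field_simp; ring
    rw [this]
    have : 0 < 2 / x := by positivity
    linarith
  have h2 : 1 / (x + 1) ^ 3 ≤ 1 / x ^ 3 :=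
    one_div_le_one_div_of_le (by positivity) (pow_le_pow_left₀ hx.le (by linarith) 3)
  have h3 : 1 / (x + 1) ^ 2 ≤ 1 / x - 1 / (x + 1) := by
    have : 1 / x - 1 / (x + 1) = 1 / (x * (x + 1)) := by field_simp; ring
    rw [this]
    exact one_div_le_one_div_of_le (by positivity) (by nlinarith)
  have h4 : θ / x ^ 2 + 6 * β ^ 4 * (1 / x ^ 3) ≤ (2 * β ^ 2 + β) * ((1 - 2 / x) / x ^ 2) := by
    have e1 : θ / x ^ 2 + 6 * β ^ 4 * (1 / x ^ 3) = (θ * x + 6 * β ^ 4) / x ^ 3 := by field_simp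
    have e2 : (2 * β ^ 2 + β) * ((1 - 2 / x) / x ^ 2) = (2 * β ^ 2 + β) * (x - 2) / x ^ 3 := by
      field_simp
    rw [e1, e2]
    refine div_le_div_of_nonneg_right ?_ (by positivity)
    linarith
  have h5 := mul_le_mul_of_nonneg_left h1 hs
  have h6 := mul_le_mul_of_nonneg_left h2 (show 0 ≤ 6 * β ^ 4 by positivity)
  have h7 := mul_le_mul_of_nonneg_left h3 hβ
  have e1 : β / x = β * (1 / x) := by ring
  have e2 : β / (x + 1) = β * (1 / (x + 1)) := by ring
  have e3 : 6 * (β ^ 4 / (x + 1) ^ 3) = 6 * β ^ 4 * (1 / (x + 1) ^ 3) := by ring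
  have e4 : 2 * (β / (x + 1)) ^ 2 = 2 * β ^ 2 * (1 / (x + 1) ^ 2) := by field_simp
  rw [e1, e3, e4, e2]
  linarith

/-- The decrease of x⁻³ is about 3x⁻⁴, which pays for the 2g⁴ generated at each step. -/
lemma quartic_weight_le {β x : ℝ} (hx : 0 < x) :
    β ^ 4 / (x + 1) ^ 3 + 2 * (β / (x + 1)) ^ 4 ≤ β ^ 4 / x ^ 3 := by
  have h : 1 / (x + 1) ^ 3 + 2 * (1 / (x + 1) ^ 4) ≤ 1 / x ^ 3 := by
    have : 1 / (x + 1) ^ 3 + 2 * (1 / (x + 1) ^ 4) = (x + 3) / (x + 1) ^ 4 := by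
      field_simp; ring
    rw [this, div_le_div_iff₀ (by positivity) (by positivity)]
    nlinarith [pow_pos hx 3, pow_pos hx 2]
  have := mul_le_mul_of_nonneg_left h (show 0 ≤ β ^ 4 by positivity)
  calc _ = β ^ 4 * (1 / (x + 1) ^ 3 + 2 * (1 / (x + 1) ^ 4)) := by field_simp
    _ ≤ _ := this
    _ = _ := by ring

end Inequalities

/-! ### The walk, and averaging over its next step. -/

section Walk

variable {Ω : Type*} {ξ : ℕ → Ω → ℝ}

lemma walk_succ (k : ℕ) (ω : Ω) : walk ξ (k + 1) ω = walk ξ k ω + ξ k ω :=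
  Finset.sum_range_succ _ _

lemma quadFunctional_succ (k : ℕ) (ω : Ω) :
    quadFunctional ξ (k + 1) ω =
      quadFunctional ξ k ω + walk ξ (k + 1) ω ^ 2 / ((k : ℝ) + 1) ^ 2 := by
  unfold quadFunctional
  rw [Finset.sum_Icc_succ_top (by omega)]
  push_cast
  rfl

lemma quadFunctional_nonneg (k : ℕ) (ω : Ω) : 0 ≤ quadFunctional ξ k ω :=
  Finset.sum_nonneg fun _ _ => by positivity

variable [MeasurableSpace Ω] {μ : Measure Ω}

namespace IsFairSigns

lemma measurable_walk (hξ : IsFairSigns μ ξ) (k : ℕ) : Measurable (walk ξ k) := by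
  unfold walk
  exact Finset.measurable_fun_sum _ fun i _ => hξ.measurable i

lemma measurable_quadFunctional (hξ : IsFairSigns μ ξ) (k : ℕ) :
    Measurable (quadFunctional ξ k) := by
  unfold quadFunctional
  exact Finset.measurable_fun_sum _ fun i _ => ((hξ.measurable_walk i).pow_const 2).div_const _

/-- The walk and the quadratic functional at time `k` are independent of the next step. -/
lemma indepFun_step (hξ : IsFairSigns μ ξ) (k : ℕ) :
    IndepFun (fun ω => (walk ξ k ω, quadFunctional ξ k ω)) (ξ k) μ := by
  have h := hξ.indep.indepFun_finset (Finset.range k) {k} (by simp) hξ.measurable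
  have hψ : Measurable fun x : (({k} : Finset ℕ) → ℝ) => x ⟨k, Finset.mem_singleton_self k⟩ :=
    measurable_pi_apply _
  -- The default 0 extends the first k steps to all indices; it is never used, as only indices below
  -- k occur.
  have hm : ∀ i, Measurable fun x : (Finset.range k → ℝ) =>
      if hi : i ∈ Finset.range k then x ⟨i, hi⟩ else 0 := by
    intro i
    split_ifs
    · exact measurable_pi_apply _
    · exact measurable_const
  have hφ : Measurable fun x : (Finset.range k → ℝ) =>
      ((∑ i ∈ Finset.range k, if hi : i ∈ Finset.range k then x ⟨i, hi⟩ else 0),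
        ∑ j ∈ Finset.Icc 1 k, (∑ i ∈ Finset.range j,
          if hi : i ∈ Finset.range k then x ⟨i, hi⟩ else 0) ^ 2 / (j : ℝ) ^ 2) :=
    (Finset.measurable_fun_sum _ fun i _ => hm i).prodMk
      (Finset.measurable_fun_sum _ fun j _ =>
        ((Finset.measurable_fun_sum _ fun i _ => hm i).pow_const 2).div_const _)
  convert h.comp hφ hψ using 1
  · ext ω : 1
    simp only [Function.comp_apply, walk, quadFunctional, Prod.mk.injEq]
    refine ⟨Finset.sum_congr rfl fun i hi => by simp [Finset.mem_range.1 hi],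
      Finset.sum_congr rfl fun j hj => ?_⟩
    congr 2
    refine Finset.sum_congr rfl fun i hi => ?_
    have : i < k := (Finset.mem_range.1 hi).trans_le (Finset.mem_Icc.1 hj).2
    simp [this]
  · rfl

lemma integral_mul_indicator (hξ : IsFairSigns μ ξ) {F : ℝ → ℝ → ℝ}
    (hF : Continuous (Function.uncurry F)) (k : ℕ) {a : ℝ} (ha : μ {ω | ξ k ω = a} = 1 / 2) :
    ∫ ω, F (walk ξ k ω) (quadFunctional ξ k ω) * Set.indicator {a} 1 (ξ k ω) ∂μ =
      (∫ ω, F (walk ξ k ω) (quadFunctional ξ k ω) ∂μ) / 2 := by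
  have hi : Measurable (Set.indicator {a} 1 : ℝ → ℝ) :=
    measurable_one.indicator (measurableSet_singleton a)
  have h := (hξ.indepFun_step k).comp hF.measurable hi
  have h2 := h.integral_fun_mul_eq_mul_integral
    ((hF.measurable.comp ((hξ.measurable_walk k).prodMk
      (hξ.measurable_quadFunctional k))).aestronglyMeasurable)
    ((hi.comp (hξ.measurable k)).aestronglyMeasurable)
  have h3 : ∫ ω, Set.indicator {a} (1 : ℝ → ℝ) (ξ k ω) ∂μ = 1 / 2 := by
    have : (fun ω => Set.indicator {a} (1 : ℝ → ℝ) (ξ k ω)) =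
        Set.indicator {ω | ξ k ω = a} 1 := by
      ext ω
      simp [Set.indicator]
    have hm : MeasurableSet {ω | ξ k ω = a} := hξ.measurable k (measurableSet_singleton a)
    rw [this, integral_indicator_one hm, measureReal_def, ha]
    simp
  simp only [Function.comp_apply, Function.uncurry] at h2
  rw [h2, h3]
  ring

variable [IsProbabilityMeasure μ]

lemma ae_eq_one_or_neg_one (hξ : IsFairSigns μ ξ) (i : ℕ) :
    ∀ᵐ ω ∂μ, ξ i ω = 1 ∨ ξ i ω = -1 := by
  have h1 : MeasurableSet {ω | ξ i ω = 1} := hξ.measurable i (measurableSet_singleton 1)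
  have h2 : MeasurableSet {ω | ξ i ω = -1} := hξ.measurable i (measurableSet_singleton (-1))
  have hd : Disjoint {ω | ξ i ω = 1} {ω | ξ i ω = -1} := by
    rw [Set.disjoint_left]
    intro ω ha hb
    simp only [Set.mem_ofPred_eq] at ha hb
    linarith
  have hu : μ ({ω | ξ i ω = 1} ∪ {ω | ξ i ω = -1}) = 1 := by
    rw [measure_union hd h2, hξ.prob_one, hξ.prob_neg_one, ENNReal.add_halves]
  exact (prob_compl_eq_zero_iff (h1.union h2)).2 hu

lemma ae_abs_walk_le (hξ : IsFairSigns μ ξ) : ∀ᵐ ω ∂μ, ∀ k : ℕ, |walk ξ k ω| ≤ k := by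
  filter_upwards [ae_all_iff.2 hξ.ae_eq_one_or_neg_one] with ω h k
  refine (Finset.abs_sum_le_sum_abs _ _).trans ?_
  refine (Finset.sum_le_card_nsmul _ _ 1 fun i _ => ?_).trans (by simp)
  rcases h i with h | h <;> simp [h]

lemma ae_quadFunctional_le (hξ : IsFairSigns μ ξ) :
    ∀ᵐ ω ∂μ, ∀ k : ℕ, quadFunctional ξ k ω ≤ k := by
  filter_upwards [hξ.ae_abs_walk_le] with ω h k
  refine (Finset.sum_le_card_nsmul _ _ 1 fun i hi => ?_).trans (by simp)
  have hi : 0 < (i : ℝ) := by exact_mod_cast (Finset.mem_Icc.1 hi).1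
  rw [div_le_one (by positivity)]
  exact sq_le_sq' (abs_le.1 (h i)).1 (abs_le.1 (h i)).2

/-- A continuous function of the walk and of the quadratic functional is integrable. -/
lemma integrable_comp (hξ : IsFairSigns μ ξ) {F : ℝ → ℝ → ℝ}
    (hF : Continuous (Function.uncurry F)) (j k : ℕ) :
    Integrable (fun ω => F (walk ξ j ω) (quadFunctional ξ k ω)) μ := by
  obtain ⟨C, hC⟩ := (isCompact_Icc (a := (-j : ℝ)) (b := (j : ℝ))).prod
    (isCompact_Icc (a := (0 : ℝ)) (b := (k : ℝ))) |>.exists_bound_of_continuousOn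
    hF.continuousOn
  refine Integrable.of_bound (C := C) (hF.measurable.comp
    ((hξ.measurable_walk j).prodMk (hξ.measurable_quadFunctional k))).aestronglyMeasurable ?_
  filter_upwards [hξ.ae_abs_walk_le, hξ.ae_quadFunctional_le] with ω h1 h2
  exact hC (walk ξ j ω, quadFunctional ξ k ω)
    ⟨abs_le.1 (h1 j), quadFunctional_nonneg k ω, h2 k⟩

/-- Averaging over the next step of the walk. -/
lemma integral_step (hξ : IsFairSigns μ ξ) {F : ℝ → ℝ → ℝ}
    (hF : Continuous (Function.uncurry F)) (k : ℕ) :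
    ∫ ω, F (walk ξ (k + 1) ω) (quadFunctional ξ k ω) ∂μ =
      ∫ ω, (F (walk ξ k ω + 1) (quadFunctional ξ k ω) +
        F (walk ξ k ω - 1) (quadFunctional ξ k ω)) / 2 ∂μ := by
  have hp : Continuous (Function.uncurry fun s l => F (s + 1) l) :=
    hF.comp (by fun_prop : Continuous fun p : ℝ × ℝ => (p.1 + 1, p.2))
  have hm : Continuous (Function.uncurry fun s l => F (s - 1) l) :=
    hF.comp (by fun_prop : Continuous fun p : ℝ × ℝ => (p.1 - 1, p.2))
  have hind : ∀ a, Measurable fun ω => (Set.indicator {a} 1 (ξ k ω) : ℝ) := fun a =>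
    (measurable_one.indicator (measurableSet_singleton a)).comp (hξ.measurable k)
  have hb : ∀ a, ∀ᵐ ω ∂μ, ‖(Set.indicator {a} 1 (ξ k ω) : ℝ)‖ ≤ 1 := fun a =>
    Eventually.of_forall fun ω => by
      by_cases h : ξ k ω = a <;> simp [h, Set.indicator]
  have h1 := (hξ.integrable_comp hp k k).mul_bdd (c := 1) (hind 1).aestronglyMeasurable (hb 1)
  have h2 := (hξ.integrable_comp hm k k).mul_bdd (c := 1) (hind (-1)).aestronglyMeasurable (hb (-1))
  have hae : (fun ω => F (walk ξ (k + 1) ω) (quadFunctional ξ k ω)) =ᵐ[μ] fun ω =>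
      F (walk ξ k ω + 1) (quadFunctional ξ k ω) * Set.indicator {1} 1 (ξ k ω) +
      F (walk ξ k ω - 1) (quadFunctional ξ k ω) * Set.indicator {-1} 1 (ξ k ω) := by
    filter_upwards [hξ.ae_eq_one_or_neg_one k] with ω h
    rw [walk_succ]
    rcases h with h | h
    · rw [h]; norm_num [Set.indicator]
    · rw [h]; norm_num [Set.indicator, sub_eq_add_neg]
  rw [integral_congr_ae hae, integral_add h1 h2,
    hξ.integral_mul_indicator hp k (hξ.prob_one k),
    hξ.integral_mul_indicator hm k (hξ.prob_neg_one k), integral_div,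
    integral_add (hξ.integrable_comp hp k k) (hξ.integrable_comp hm k k)]
  ring

/-! ### Exponential moments through the Riccati weights. -/

lemma integrable_exp (hξ : IsFairSigns μ ξ) (θ : ℝ) (n : ℕ) :
    Integrable (fun ω => Real.exp (-θ * quadFunctional ξ n ω)) μ :=
  hξ.integrable_comp (F := fun _ l => Real.exp (-θ * l))
    (by simp only [Function.uncurry_def]; fun_prop) 0 n

lemma integrable_exp_walk (hξ : IsFairSigns μ ξ) (θ g d : ℝ) (j k : ℕ) :
    Integrable (fun ω => Real.exp (-θ * quadFunctional ξ k ω) *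
      Real.exp (-g * walk ξ j ω ^ 2 - d * walk ξ j ω ^ 4)) μ :=
  hξ.integrable_comp (F := fun s l => Real.exp (-θ * l) * Real.exp (-g * s ^ 2 - d * s ^ 4))
    (by simp only [Function.uncurry_def]; fun_prop) j k

lemma integral_exp_step_le (hξ : IsFairSigns μ ξ) (θ g : ℝ) (k : ℕ) :
    ∫ ω, Real.exp (-θ * quadFunctional ξ k ω) * Real.exp (-g * walk ξ (k + 1) ω ^ 2) ∂μ ≤
      Real.exp (-g) * ∫ ω, Real.exp (-θ * quadFunctional ξ k ω) *
        Real.exp (-(g - 2 * g ^ 2) * walk ξ k ω ^ 2) ∂μ := by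
  rw [hξ.integral_step (F := fun s l => Real.exp (-θ * l) * Real.exp (-g * s ^ 2))
    (by simp only [Function.uncurry_def]; fun_prop) k, ← integral_const_mul]
  refine integral_mono
    (hξ.integrable_comp (F := fun s l => (Real.exp (-θ * l) * Real.exp (-g * (s + 1) ^ 2) +
      Real.exp (-θ * l) * Real.exp (-g * (s - 1) ^ 2)) / 2)
      (by simp only [Function.uncurry_def]; fun_prop) k k)
    (hξ.integrable_comp (F := fun s l => Real.exp (-g) * (Real.exp (-θ * l) *
      Real.exp (-(g - 2 * g ^ 2) * s ^ 2)))
      (by simp only [Function.uncurry_def]; fun_prop) k k) fun ω => ?_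
  have h := mul_le_mul_of_nonneg_left (exp_average_le g (walk ξ k ω))
    (Real.exp_pos (-θ * quadFunctional ξ k ω)).le
  calc _ = _ := by ring
    _ ≤ _ := h
    _ = _ := by ring

lemma le_integral_exp_step (hξ : IsFairSigns μ ξ) (θ : ℝ) {g d : ℝ} (hg : 0 ≤ g) (hd : 0 ≤ d)
    (k : ℕ) :
    Real.exp (-(g + d)) * ∫ ω, Real.exp (-θ * quadFunctional ξ k ω) *
        Real.exp (-(g + 6 * d - 2 * g ^ 2) * walk ξ k ω ^ 2 -
          (d + 2 * g ^ 4) * walk ξ k ω ^ 4) ∂μ ≤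
      ∫ ω, Real.exp (-θ * quadFunctional ξ k ω) *
        Real.exp (-g * walk ξ (k + 1) ω ^ 2 - d * walk ξ (k + 1) ω ^ 4) ∂μ := by
  rw [hξ.integral_step
    (F := fun s l => Real.exp (-θ * l) * Real.exp (-g * s ^ 2 - d * s ^ 4))
    (by simp only [Function.uncurry_def]; fun_prop) k, ← integral_const_mul]
  refine integral_mono ((hξ.integrable_exp_walk θ _ _ k k).const_mul _)
    (hξ.integrable_comp (F := fun s l =>
      (Real.exp (-θ * l) * Real.exp (-g * (s + 1) ^ 2 - d * (s + 1) ^ 4) +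
      Real.exp (-θ * l) * Real.exp (-g * (s - 1) ^ 2 - d * (s - 1) ^ 4)) / 2)
      (by simp only [Function.uncurry_def]; fun_prop) k k) fun ω => ?_
  have h := mul_le_mul_of_nonneg_left (le_exp_average hg hd (walk ξ k ω))
    (Real.exp_pos (-θ * quadFunctional ξ k ω)).le
  calc _ = _ := by ring
    _ ≤ _ := h
    _ = _ := by ring

/-- Exponential moments of the quadratic functional: upper bound. -/
lemma integral_exp_le (hξ : IsFairSigns μ ξ) {β : ℝ} (hβ : 0 ≤ β) {n : ℕ} (hn : 1 ≤ n) :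
    ∫ ω, Real.exp (-(2 * β ^ 2 + β) * quadFunctional ξ n ω) ∂μ ≤
      Real.exp (2 * β) * Real.exp (-β * Real.log n) := by
  set θ := 2 * β ^ 2 + β with hθ
  have hθ0 : 0 ≤ θ := by positivity
  -- Comparing ∑ 1/j with the logarithm gives the power of k; the shifts by 1/n cost at most β k/n
  -- in total, a bounded amount.
  have key : ∀ k : ℕ, k + 1 ≤ n →
      ∫ ω, Real.exp (-θ * quadFunctional ξ k ω) *
        Real.exp (-(β * (1 / ((k : ℝ) + 1) - 1 / n)) * walk ξ (k + 1) ω ^ 2) ∂μ ≤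
      Real.exp (-β * (Real.log ((k : ℝ) + 2) - Real.log 2) + β * k / n) := by
    intro k
    induction k with
    | zero =>
      intro _
      have : ∫ ω, Real.exp (-θ * quadFunctional ξ 0 ω) *
        Real.exp (-(β * (1 / (((0 : ℕ) : ℝ) + 1) - 1 / n)) * walk ξ (0 + 1) ω ^ 2) ∂μ ≤
          ∫ _, (1 : ℝ) ∂μ := by
        refine integral_mono (hξ.integrable_comp (F := fun s l => Real.exp (-θ * l) *
          Real.exp (-(β * (1 / (((0 : ℕ) : ℝ) + 1) - 1 / n)) * s ^ 2))
          (by simp only [Function.uncurry_def]; fun_prop) 1 0) (integrable_const _) fun ω => ?_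
        have h0 : quadFunctional ξ 0 ω = 0 := by simp [quadFunctional]
        have h1 : 1 / (n : ℝ) ≤ 1 := by
          rw [div_le_one (by positivity)]; exact_mod_cast hn
        have h2 : 0 ≤ β * (1 - 1 / n) * walk ξ 1 ω ^ 2 :=
          mul_nonneg (mul_nonneg hβ (by linarith)) (sq_nonneg _)
        simp only [h0, mul_zero, Real.exp_zero, one_mul, Nat.cast_zero, zero_add, div_one]
        rw [Real.exp_le_one_iff]
        linarith
      refine this.trans (by simp)
    | succ k ih =>
      intro hk
      have hkn : ((k : ℝ) + 1) + 1 ≤ n := by exact_mod_cast hk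
      have hk0 : (0 : ℝ) < (k : ℝ) + 1 := by positivity
      have hn0 : (0 : ℝ) < n := by linarith
      have hric := riccati_le hβ hk0 hkn
      set g := β * (1 / ((k : ℝ) + 1 + 1) - 1 / n) with hg
      have hstep := hξ.integral_exp_step_le θ g (k + 1)
      have hmono : ∫ ω, Real.exp (-θ * quadFunctional ξ (k + 1) ω) *
            Real.exp (-(g - 2 * g ^ 2) * walk ξ (k + 1) ω ^ 2) ∂μ ≤
          ∫ ω, Real.exp (-θ * quadFunctional ξ k ω) *
            Real.exp (-(β * (1 / ((k : ℝ) + 1) - 1 / n)) * walk ξ (k + 1) ω ^ 2) ∂μ := by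
        refine integral_mono (hξ.integrable_comp (F := fun s l => Real.exp (-θ * l) *
          Real.exp (-(g - 2 * g ^ 2) * s ^ 2))
          (by simp only [Function.uncurry_def]; fun_prop) (k + 1) (k + 1))
          (hξ.integrable_comp (F := fun s l => Real.exp (-θ * l) *
          Real.exp (-(β * (1 / ((k : ℝ) + 1) - 1 / n)) * s ^ 2))
          (by simp only [Function.uncurry_def]; fun_prop) (k + 1) k) fun ω => ?_
        simp only [← Real.exp_add]
        rw [Real.exp_le_exp, quadFunctional_succ]
        have := mul_le_mul_of_nonneg_right hric (sq_nonneg (walk ξ (k + 1) ω))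
        have e : θ / ((k : ℝ) + 1) ^ 2 * walk ξ (k + 1) ω ^ 2 =
          θ * (walk ξ (k + 1) ω ^ 2 / ((k : ℝ) + 1) ^ 2) := by ring
        linarith
      push_cast
      refine (hstep.trans (mul_le_mul_of_nonneg_left (hmono.trans (ih (by omega)))
        (Real.exp_pos _).le)).trans ?_
      rw [← Real.exp_add, Real.exp_le_exp]
      have hl := mul_le_mul_of_nonneg_left
        (log_succ_sub_log_le (show (0 : ℝ) < (k : ℝ) + 2 by positivity)) hβ
      have e1 : (k : ℝ) + 2 + 1 = (k : ℝ) + 1 + 2 := by ring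
      have e2 : (k : ℝ) + 1 + 1 = (k : ℝ) + 2 := by ring
      rw [e1] at hl
      rw [hg, e2]
      have e3 : β * ((k : ℝ) + 1) / n = β * k / n + β * (1 / n) := by ring
      rw [e3]
      linarith
  obtain ⟨m, rfl⟩ : ∃ m, n = m + 1 := ⟨n - 1, by omega⟩
  have hm := key m le_rfl
  have hm0 : (0 : ℝ) < (m : ℝ) + 1 := by positivity
  -- At the final time the weight vanishes, so only the last summand of the functional is dropped.
  have hle : ∫ ω, Real.exp (-θ * quadFunctional ξ (m + 1) ω) ∂μ ≤
      ∫ ω, Real.exp (-θ * quadFunctional ξ m ω) * Real.exp (-(β * (1 / ((m : ℝ) + 1) -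
        1 / ((m + 1 : ℕ) : ℝ))) * walk ξ (m + 1) ω ^ 2) ∂μ := by
    refine integral_mono (hξ.integrable_exp θ _)
      (hξ.integrable_comp (F := fun s l => Real.exp (-θ * l) * Real.exp (-(β * (1 / ((m : ℝ) + 1) -
        1 / ((m + 1 : ℕ) : ℝ))) * s ^ 2))
      (by simp only [Function.uncurry_def]; fun_prop) _ _) fun ω => ?_
    simp only [Nat.cast_add, Nat.cast_one, sub_self, mul_zero, neg_zero, zero_mul, Real.exp_zero,
      mul_one]
    rw [Real.exp_le_exp, quadFunctional_succ]
    have : 0 ≤ θ * (walk ξ (m + 1) ω ^ 2 / ((m : ℝ) + 1) ^ 2) := by positivity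
    linarith
  refine hle.trans (hm.trans ?_)
  rw [← Real.exp_add, Real.exp_le_exp]
  push_cast
  have h1 : Real.log ((m : ℝ) + 1) ≤ Real.log ((m : ℝ) + 2) :=
    Real.log_le_log hm0 (by linarith)
  have h2 : Real.log 2 ≤ 1 := by
    have := Real.log_le_sub_one_of_pos (show (0 : ℝ) < 2 by norm_num)
    linarith
  have h3 : β * m / ((m : ℝ) + 1) ≤ β := by
    rw [div_le_iff₀ hm0]
    nlinarith
  nlinarith [mul_le_mul_of_nonneg_left h1 hβ, mul_le_mul_of_nonneg_left h2 hβ]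

/-- Exponential moments of the quadratic functional: lower bound. -/
lemma exists_le_integral_exp (hξ : IsFairSigns μ ξ) {β θ : ℝ} (hβ : 0 < β)
    (hθ : θ < 2 * β ^ 2 + β) :
    ∃ C : ℝ, 0 < C ∧ ∀ᶠ n : ℕ in atTop, C * Real.exp (-β * Real.log n) ≤
      ∫ ω, Real.exp (-θ * quadFunctional ξ n ω) ∂μ := by
  -- The first threshold lets the final weight dominate the last summand of the functional; the
  -- second is the one required by `le_riccati`.
  obtain ⟨m, hm⟩ := exists_nat_ge (max (θ / β)
    ((2 * (2 * β ^ 2 + β) + 6 * β ^ 4) / (2 * β ^ 2 + β - θ)))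
  have hm1 := (le_max_left _ _).trans hm
  have hm2 := (le_max_right _ _).trans hm
  set J : ℕ → ℝ := fun k => ∫ ω, Real.exp (-θ * quadFunctional ξ k ω) *
    Real.exp (-(β / ((k : ℝ) + 1)) * walk ξ (k + 1) ω ^ 2 -
      β ^ 4 / ((k : ℝ) + 1) ^ 3 * walk ξ (k + 1) ω ^ 4) ∂μ with hJ
  have hJm : 0 < J m := by
    rw [hJ]
    have hint := hξ.integrable_exp_walk θ (β / ((m : ℝ) + 1)) (β ^ 4 / ((m : ℝ) + 1) ^ 3)
      (m + 1) m
    have hpos : ∀ ω, 0 < Real.exp (-θ * quadFunctional ξ m ω) *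
        Real.exp (-(β / ((m : ℝ) + 1)) * walk ξ (m + 1) ω ^ 2 -
          β ^ 4 / ((m : ℝ) + 1) ^ 3 * walk ξ (m + 1) ω ^ 4) := fun ω => by positivity
    refine (integral_pos_iff_support_of_nonneg (fun ω => (hpos ω).le) hint).2 ?_
    rw [Function.support_eq_univ fun ω => (hpos ω).ne']
    simp
  have hstep : ∀ k, m ≤ k →
      Real.exp (-(β / ((k : ℝ) + 2) + β ^ 4 / ((k : ℝ) + 2) ^ 3)) * J k ≤ J (k + 1) := by
    intro k hk
    have hk0 : (0 : ℝ) < (k : ℝ) + 1 := by positivity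
    have hmk : (m : ℝ) ≤ k := by exact_mod_cast hk
    have hr := le_riccati hβ.le hk0 hθ (by linarith)
    have hq := quartic_weight_le (β := β) hk0
    have e2 : (k : ℝ) + 1 + 1 = (k : ℝ) + 2 := by ring
    rw [e2] at hr hq
    have hs := hξ.le_integral_exp_step θ (g := β / ((k : ℝ) + 2))
      (d := β ^ 4 / ((k : ℝ) + 2) ^ 3) (by positivity) (by positivity) (k + 1)
    simp only [hJ]
    push_cast
    rw [e2]
    refine le_trans (mul_le_mul_of_nonneg_left ?_ (Real.exp_pos _).le) hs
    refine integral_mono (hξ.integrable_exp_walk _ _ _ _ _) (hξ.integrable_exp_walk _ _ _ _ _)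
      fun ω => ?_
    simp only [← Real.exp_add]
    rw [Real.exp_le_exp, quadFunctional_succ]
    have h1 := mul_le_mul_of_nonneg_right hr (sq_nonneg (walk ξ (k + 1) ω))
    have h2 := mul_le_mul_of_nonneg_right hq
      (show 0 ≤ walk ξ (k + 1) ω ^ 4 by positivity)
    have e : θ / ((k : ℝ) + 1) ^ 2 * walk ξ (k + 1) ω ^ 2 =
      θ * (walk ξ (k + 1) ω ^ 2 / ((k : ℝ) + 1) ^ 2) := by ring
    linarith
  set C := J m / Real.exp (-β * Real.log ((m : ℝ) + 1) + β ^ 4 / ((m : ℝ) + 1)) with hC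
  have hC0 : 0 < C := by positivity
  -- The term β⁴/(k+1) telescopes to absorb the quartic costs β⁴/(k+2)³.
  have key : ∀ k, m ≤ k →
      C * Real.exp (-β * Real.log ((k : ℝ) + 1) + β ^ 4 / ((k : ℝ) + 1)) ≤ J k := by
    intro k hk
    induction k, hk using Nat.le_induction with
    | base => rw [hC, div_mul_cancel₀ _ (Real.exp_pos _).ne']
    | succ k hk ih =>
      refine le_trans ?_ ((mul_le_mul_of_nonneg_left ih (Real.exp_pos _).le).trans (hstep k hk))
      rw [mul_left_comm, ← Real.exp_add]
      refine mul_le_mul_of_nonneg_left (Real.exp_le_exp.2 ?_) hC0.le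
      have hk0 : (0 : ℝ) < (k : ℝ) + 1 := by positivity
      have hl := mul_le_mul_of_nonneg_left (le_log_succ_sub_log hk0) hβ.le
      have e2 : (k : ℝ) + 1 + 1 = (k : ℝ) + 2 := by ring
      push_cast
      rw [e2] at hl ⊢
      have hd : 1 / ((k : ℝ) + 2) ^ 3 ≤ 1 / ((k : ℝ) + 1) - 1 / ((k : ℝ) + 2) := by
        have : 1 / ((k : ℝ) + 1) - 1 / ((k : ℝ) + 2) = 1 / (((k : ℝ) + 1) * ((k : ℝ) + 2)) := by
          field_simp; ring
        rw [this]
        refine one_div_le_one_div_of_le (by positivity) ?_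
        have hk' : (0 : ℝ) ≤ k := by positivity
        nlinarith [pow_nonneg hk' 3, pow_nonneg hk' 2]
      have hd' := mul_le_mul_of_nonneg_left hd (show 0 ≤ β ^ 4 by positivity)
      have e3 : β ^ 4 / ((k : ℝ) + 2) ^ 3 = β ^ 4 * (1 / ((k : ℝ) + 2) ^ 3) := by ring
      have e4 : β ^ 4 / ((k : ℝ) + 1) = β ^ 4 * (1 / ((k : ℝ) + 1)) := by ring
      have e5 : β ^ 4 / ((k : ℝ) + 2) = β ^ 4 * (1 / ((k : ℝ) + 2)) := by ring
      have e6 : β / ((k : ℝ) + 2) = β * (1 / ((k : ℝ) + 2)) := by ring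
      rw [e3, e4, e5, e6]
      linarith
  refine ⟨C, hC0, ?_⟩
  filter_upwards [eventually_ge_atTop (m + 1)] with n hn
  obtain ⟨k, rfl⟩ : ∃ k, n = k + 1 := ⟨n - 1, by omega⟩
  have hk : m ≤ k := by omega
  have hk0 : (0 : ℝ) < (k : ℝ) + 1 := by positivity
  have hmk : (m : ℝ) ≤ k := by exact_mod_cast hk
  have hw : θ / ((k : ℝ) + 1) ^ 2 ≤ β / ((k : ℝ) + 1) := by
    rw [div_le_iff₀ hβ] at hm1
    rw [div_le_div_iff₀ (by positivity) hk0]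
    nlinarith [mul_le_mul_of_nonneg_right (show θ ≤ (k + 1) * β by nlinarith) hk0.le]
  calc C * Real.exp (-β * Real.log ((k + 1 : ℕ) : ℝ))
      ≤ C * Real.exp (-β * Real.log ((k : ℝ) + 1) + β ^ 4 / ((k : ℝ) + 1)) := by
        refine mul_le_mul_of_nonneg_left (Real.exp_le_exp.2 ?_) hC0.le
        push_cast
        have : 0 ≤ β ^ 4 / ((k : ℝ) + 1) := by positivity
        linarith
    _ ≤ J k := key k hk
    _ ≤ _ := by
        refine integral_mono (hξ.integrable_exp_walk _ _ _ _ _) (hξ.integrable_exp _ _)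
          fun ω => ?_
        simp only [← Real.exp_add]
        rw [Real.exp_le_exp, quadFunctional_succ]
        have h1 := mul_le_mul_of_nonneg_right hw (sq_nonneg (walk ξ (k + 1) ω))
        have h2 : 0 ≤ β ^ 4 / ((k : ℝ) + 1) ^ 3 * walk ξ (k + 1) ω ^ 4 := by positivity
        have e : θ / ((k : ℝ) + 1) ^ 2 * walk ξ (k + 1) ω ^ 2 =
          θ * (walk ξ (k + 1) ω ^ 2 / ((k : ℝ) + 1) ^ 2) := by ring
        linarith

/-! ### From exponential moments to the lower tail. -/

/-- The Chernoff bound for the lower tail. -/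
lemma measureReal_le (hξ : IsFairSigns μ ξ) {β : ℝ} (hβ : 0 ≤ β) (c : ℝ) {n : ℕ} (hn : 1 ≤ n) :
    μ.real {ω | quadFunctional ξ n ω ≤ c * Real.log n} ≤
      Real.exp (2 * β) * Real.exp (-(β - (2 * β ^ 2 + β) * c) * Real.log n) := by
  set θ := 2 * β ^ 2 + β with hθ
  have hθ0 : 0 ≤ θ := by positivity
  have hms : MeasurableSet {ω | quadFunctional ξ n ω ≤ c * Real.log n} :=
    measurableSet_le (hξ.measurable_quadFunctional n) measurable_const
  calc μ.real {ω | quadFunctional ξ n ω ≤ c * Real.log n}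
      = ∫ ω, Set.indicator {ω | quadFunctional ξ n ω ≤ c * Real.log n} 1 ω ∂μ :=
        (integral_indicator_one hms).symm
    _ ≤ ∫ ω, Real.exp (θ * (c * Real.log n)) * Real.exp (-θ * quadFunctional ξ n ω) ∂μ := by
        refine integral_mono ((integrable_const (1 : ℝ)).indicator hms)
          ((hξ.integrable_exp θ n).const_mul _) fun ω => ?_
        by_cases h : quadFunctional ξ n ω ≤ c * Real.log n
        · simp only [Set.indicator, Set.mem_ofPred_eq, h, if_true, Pi.one_apply]
          rw [← Real.exp_add]
          refine Real.one_le_exp ?_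
          nlinarith [mul_le_mul_of_nonneg_left h hθ0]
        · simp only [Set.indicator, Set.mem_ofPred_eq, h, if_false]
          positivity
    _ ≤ Real.exp (θ * (c * Real.log n)) * (Real.exp (2 * β) * Real.exp (-β * Real.log n)) := by
        rw [integral_const_mul]
        exact mul_le_mul_of_nonneg_left (hξ.integral_exp_le hβ hn) (Real.exp_pos _).le
    _ = _ := by
        rw [← Real.exp_add, ← Real.exp_add, ← Real.exp_add]
        ring_nf

/-- An exponential moment is at most the sum of the contributions of the events
`quadFunctional ≤ a`, `quadFunctional ≥ c` and `a ≤ quadFunctional ≤ c`, the first two of which are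
bounded by changing the parameter. -/
lemma integral_exp_le_add (hξ : IsFairSigns μ ξ) {θ θ₁ θ₂ : ℝ} (hθ : 0 ≤ θ) (h₁ : θ ≤ θ₁)
    (h₂ : θ₂ ≤ θ) (a c : ℝ) (n : ℕ) :
    ∫ ω, Real.exp (-θ * quadFunctional ξ n ω) ∂μ ≤
      Real.exp ((θ₁ - θ) * a) * ∫ ω, Real.exp (-θ₁ * quadFunctional ξ n ω) ∂μ +
      Real.exp (-(θ - θ₂) * c) * ∫ ω, Real.exp (-θ₂ * quadFunctional ξ n ω) ∂μ +
      Real.exp (-θ * a) * μ.real {ω | quadFunctional ξ n ω ≤ c} := by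
  have hms : MeasurableSet {ω | quadFunctional ξ n ω ≤ c} :=
    measurableSet_le (hξ.measurable_quadFunctional n) measurable_const
  have hi1 := (hξ.integrable_exp θ₁ n).const_mul (Real.exp ((θ₁ - θ) * a))
  have hi2 := (hξ.integrable_exp θ₂ n).const_mul (Real.exp (-(θ - θ₂) * c))
  have hi3 : Integrable (fun ω => Real.exp (-θ * a) *
      Set.indicator {ω | quadFunctional ξ n ω ≤ c} (1 : Ω → ℝ) ω) μ :=
    ((integrable_const (1 : ℝ)).indicator hms).const_mul _
  rw [← integral_indicator_one hms, ← integral_const_mul, ← integral_const_mul,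
    ← integral_const_mul, ← integral_add hi1 hi2]
  refine (integral_mono (hξ.integrable_exp θ n) ((hi1.add hi2).add hi3) fun ω => ?_).trans
    (integral_add (hi1.add hi2) hi3).le
  simp only [Pi.add_apply, ← Real.exp_add]
  have p1 := Real.exp_pos ((θ₁ - θ) * a + -θ₁ * quadFunctional ξ n ω)
  have p2 := Real.exp_pos (-(θ - θ₂) * c + -θ₂ * quadFunctional ξ n ω)
  have p3 := Real.exp_pos (-θ * a)
  by_cases h : quadFunctional ξ n ω ≤ c
  · simp only [Set.indicator, Set.mem_ofPred_eq, h, if_true, Pi.one_apply, mul_one]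
    rcases le_total a (quadFunctional ξ n ω) with h' | h'
    · have : Real.exp (-θ * quadFunctional ξ n ω) ≤ Real.exp (-θ * a) := by
        rw [Real.exp_le_exp]
        nlinarith
      linarith
    · have : Real.exp (-θ * quadFunctional ξ n ω) ≤
          Real.exp ((θ₁ - θ) * a + -θ₁ * quadFunctional ξ n ω) := by
        rw [Real.exp_le_exp]
        nlinarith
      linarith
  · simp only [Set.indicator, Set.mem_ofPred_eq, h, if_false, mul_zero, add_zero]
    have : Real.exp (-θ * quadFunctional ξ n ω) ≤
        Real.exp (-(θ - θ₂) * c + -θ₂ * quadFunctional ξ n ω) := by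
      rw [Real.exp_le_exp]
      nlinarith
    linarith

/-- Lower bound for the lower tail: under the exponential tilting with parameter `2 * b ^ 2 + b`
the quadratic functional concentrates around `log n / (1 + 4 * b)`. -/
lemma eventually_le_measureReal (hξ : IsFairSigns μ ξ) {b δ : ℝ} (hδ : 0 < δ)
    (hδb : δ ≤ 4 * b) :
    ∀ᶠ n : ℕ in atTop,
      Real.exp (-(b + δ ^ 2 / 8 - (2 * b ^ 2 + b) * ((1 - δ) / (1 + 4 * b))) * Real.log n) ≤
        μ.real {ω | quadFunctional ξ n ω ≤ (1 + δ) / (1 + 4 * b) * Real.log n} := by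
  have hb : 0 < b := by linarith
  set u := (1 + δ) / (1 + 4 * b) with hu
  set l := (1 - δ) / (1 + 4 * b) with hl
  -- This shift minimises -xδ + 2x²; the minimum -δ²/8 is the exponential gain outside the window.
  set x := δ / 4 with hx
  set θ := 2 * b ^ 2 + b with hθ
  set θ₁ := 2 * (b + x) ^ 2 + (b + x) with hθ₁
  set θ₂ := 2 * (b - x) ^ 2 + (b - x) with hθ₂
  have hx0 : 0 < x := by positivity
  have hxb : x ≤ b := by rw [hx]; linarith
  have hθ0 : 0 ≤ θ := by positivity
  have hu1 : u ≤ 1 := by rw [hu, div_le_one (by positivity)]; linarith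
  have hl1 : l ≤ 1 := by rw [hl, div_le_one (by positivity)]; linarith
  have hue : u * (1 + 4 * b) = 1 + δ := div_mul_cancel₀ _ (by positivity)
  have hle : l * (1 + 4 * b) = 1 - δ := div_mul_cancel₀ _ (by positivity)
  have hδx : δ = 4 * x := by rw [hx]; ring
  have hθθ₁ : θ ≤ θ₁ := by rw [hθ, hθ₁]; nlinarith
  have hθθ₂ : θ₂ ≤ θ := by rw [hθ, hθ₂]; nlinarith
  have hexp1 : (θ₁ - θ) * l - (b + x) ≤ -(b + δ ^ 2 / 8) := by
    have : (θ₁ - θ) * l = x * (l * (1 + 4 * b)) + 2 * x ^ 2 * l := by rw [hθ, hθ₁]; ring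
    rw [this, hle, hδx]
    nlinarith [mul_le_mul_of_nonneg_left hl1 (sq_nonneg x)]
  have hexp2 : -(θ - θ₂) * u - (b - x) ≤ -(b + δ ^ 2 / 8) := by
    have : -(θ - θ₂) * u = -x * (u * (1 + 4 * b)) + 2 * x ^ 2 * u := by rw [hθ, hθ₂]; ring
    rw [this, hue, hδx]
    nlinarith [mul_le_mul_of_nonneg_left hu1 (sq_nonneg x)]
  have hr : 0 < δ ^ 2 / 16 := by positivity
  -- Half of that gain is spent on the strict inequality for θ; the other half makes the total
  -- moment dominate both tails.
  obtain ⟨C, hC, hlow⟩ := hξ.exists_le_integral_exp (β := b + δ ^ 2 / 16) (θ := θ)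
    (by positivity) (by rw [hθ]; nlinarith)
  have hlogn : Tendsto (fun n : ℕ => Real.log n) atTop atTop :=
    Real.tendsto_log_atTop.comp tendsto_natCast_atTop_atTop
  have hlarge : Tendsto (fun n : ℕ => C * Real.exp (δ ^ 2 / 16 * Real.log n)) atTop atTop :=
    (Real.tendsto_exp_atTop.comp (hlogn.const_mul_atTop hr)).const_mul_atTop hC
  filter_upwards [hlow, hlarge.eventually_ge_atTop (2 * Real.exp (2 * (b + x)) + 1),
    hlogn.eventually_ge_atTop 0, eventually_ge_atTop 1] with n hn1 hn2 hT hn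
  set T := Real.log n with hTdef
  set P := μ.real {ω | quadFunctional ξ n ω ≤ u * T} with hP
  have hsplit := hξ.integral_exp_le_add hθ0 hθθ₁ hθθ₂ (l * T) (u * T) n
  have hU₁ := mul_le_mul_of_nonneg_left (hξ.integral_exp_le (β := b + x) (by positivity) hn)
    (Real.exp_pos ((θ₁ - θ) * (l * T))).le
  have hU₂ := mul_le_mul_of_nonneg_left (hξ.integral_exp_le (β := b - x) (by linarith) hn)
    (Real.exp_pos (-(θ - θ₂) * (u * T))).le
  rw [← hP] at hsplit
  rw [← hθ₁, ← hTdef] at hU₁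
  rw [← hθ₂, ← hTdef] at hU₂
  have hA : Real.exp ((θ₁ - θ) * (l * T)) * (Real.exp (2 * (b + x)) * Real.exp (-(b + x) * T)) ≤
      Real.exp (2 * (b + x)) * Real.exp (-(b + δ ^ 2 / 8) * T) := by
    rw [mul_left_comm, ← Real.exp_add]
    refine mul_le_mul_of_nonneg_left (Real.exp_le_exp.2 ?_) (Real.exp_pos _).le
    nlinarith [mul_le_mul_of_nonneg_right hexp1 hT]
  have hB : Real.exp (-(θ - θ₂) * (u * T)) * (Real.exp (2 * (b - x)) * Real.exp (-(b - x) * T)) ≤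
      Real.exp (2 * (b + x)) * Real.exp (-(b + δ ^ 2 / 8) * T) := by
    rw [mul_left_comm, ← Real.exp_add]
    refine mul_le_mul (Real.exp_le_exp.2 (by linarith)) (Real.exp_le_exp.2 ?_)
      (Real.exp_pos _).le (Real.exp_pos _).le
    nlinarith [mul_le_mul_of_nonneg_right hexp2 hT]
  have hD : C * Real.exp (-(b + δ ^ 2 / 16) * T) =
      C * Real.exp (δ ^ 2 / 16 * T) * Real.exp (-(b + δ ^ 2 / 8) * T) := by
    rw [mul_assoc, ← Real.exp_add]
    ring_nf
  -- The two tails use up 2 exp(2(b+x)) copies of the left side; the extra 1 in `hn2` leaves one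
  -- copy.
  have hE : Real.exp (-(b + δ ^ 2 / 8) * T) ≤ Real.exp (-θ * (l * T)) * P := by
    have := mul_le_mul_of_nonneg_right hn2 (Real.exp_pos (-(b + δ ^ 2 / 8) * T)).le
    linarith
  calc Real.exp (-(b + δ ^ 2 / 8 - θ * l) * T)
      = Real.exp (θ * (l * T)) * Real.exp (-(b + δ ^ 2 / 8) * T) := by
        rw [← Real.exp_add]; ring_nf
    _ ≤ Real.exp (θ * (l * T)) * (Real.exp (-θ * (l * T)) * P) :=
        mul_le_mul_of_nonneg_left hE (Real.exp_pos _).le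
    _ = P := by
        rw [← mul_assoc, ← Real.exp_add]
        simp

lemma eventually_le_exp (hξ : IsFairSigns μ ξ) {c : ℝ} (hc0 : 0 < c) (hc1 : c < 1) {η : ℝ}
    (hη : 0 < η) :
    ∀ᶠ n : ℕ in atTop, μ.real {ω | quadFunctional ξ n ω ≤ c * Real.log n} ≤
      Real.exp (-(rate c - η) * Real.log n) := by
  have hlogn : Tendsto (fun n : ℕ => Real.log n) atTop atTop :=
    Real.tendsto_log_atTop.comp tendsto_natCast_atTop_atTop
  set β := (1 - c) / (4 * c) with hβ
  have hβ0 : 0 ≤ β := div_nonneg (by linarith) (by positivity)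
  have hrate : β - (2 * β ^ 2 + β) * c = rate c := by
    rw [hβ, rate]
    field_simp
    ring
  filter_upwards [(hlogn.const_mul_atTop hη).eventually_ge_atTop (2 * β),
    eventually_ge_atTop 1] with n hn hn1
  refine (hξ.measureReal_le hβ0 c hn1).trans ?_
  rw [hrate, ← Real.exp_add, Real.exp_le_exp]
  linarith

lemma eventually_exp_le (hξ : IsFairSigns μ ξ) {c : ℝ} (hc0 : 0 < c) (hc1 : c < 1) {η : ℝ}
    (hη : 0 < η) :
    ∀ᶠ n : ℕ in atTop, Real.exp (-(rate c + η) * Real.log n) ≤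
      μ.real {ω | quadFunctional ξ n ω ≤ c * Real.log n} := by
  have hlogn : Tendsto (fun n : ℕ => Real.log n) atTop atTop :=
    Real.tendsto_log_atTop.comp tendsto_natCast_atTop_atTop
  -- Chosen so that the upper end (1+δ)/(1+4b) of the window is exactly c; letting δ → 0 then gives
  -- the rate.
  let b : ℝ → ℝ := fun δ => ((1 + δ) / c - 1) / 4
  let f : ℝ → ℝ := fun δ => b δ + δ ^ 2 / 8 - (2 * b δ ^ 2 + b δ) * ((1 - δ) / ((1 + δ) / c))
  have hf : ContinuousAt f 0 := by
    have h0 : (1 + (0 : ℝ)) / c ≠ 0 := by positivity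
    simp only [f, b]
    fun_prop (disch := assumption)
  have hf0 : f 0 = rate c := by
    simp only [f, b, rate]
    field_simp
    ring
  have hev : ∀ᶠ δ in 𝓝[>] (0 : ℝ), f δ < rate c + η :=
    (hf.eventually_lt_const (by rw [hf0]; linarith)).filter_mono nhdsWithin_le_nhds
  obtain ⟨δ, hδf, hδ0⟩ := (hev.and self_mem_nhdsWithin).exists
  have hb4 : 1 + 4 * b δ = (1 + δ) / c := by simp only [b]; ring
  have hδb : δ ≤ 4 * b δ := by
    have : 1 + δ ≤ (1 + δ) / c := by
      rw [le_div_iff₀ hc0]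
      nlinarith
    linarith
  filter_upwards [hξ.eventually_le_measureReal hδ0 hδb, hlogn.eventually_ge_atTop 0]
    with n hn hT
  rw [hb4, show (1 + δ) / ((1 + δ) / c) = c by field_simp] at hn
  refine le_trans (Real.exp_le_exp.2 ?_) hn
  have := mul_le_mul_of_nonneg_right hδf.le hT
  simp only [f] at this
  linarith

end IsFairSigns

end Walk

end SimpleWalk

theorem theorem1p1 {Ω : Type*} [MeasurableSpace Ω] (μ : Measure Ω) [IsProbabilityMeasure μ]
    (ξ : ℕ → Ω → ℝ) (hξ : SimpleWalk.IsFairSigns μ ξ) (c : ℝ) (hc0 : 0 < c) (hc1 : c < 1) :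
    ∃ ε : ℕ → ℝ, Tendsto ε atTop (𝓝 0) ∧
      ∀ᶠ n : ℕ in atTop,
        μ.real {ω | SimpleWalk.quadFunctional ξ n ω ≤ c * Real.log n} =
          Real.exp (-(SimpleWalk.rate c + ε n) * Real.log n) := by
  have hlogn : Tendsto (fun n : ℕ => Real.log n) atTop atTop :=
    Real.tendsto_log_atTop.comp tendsto_natCast_atTop_atTop
  set P : ℕ → ℝ := fun n => μ.real {ω | SimpleWalk.quadFunctional ξ n ω ≤ c * Real.log n}
    with hP
  -- Solving the required identity for ε; the lower bound guarantees P n > 0, so the logarithm is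
  -- legitimate.
  refine ⟨fun n => -Real.log (P n) / Real.log n - SimpleWalk.rate c, ?_, ?_⟩
  · rw [Metric.tendsto_nhds]
    intro η hη
    filter_upwards [hξ.eventually_le_exp hc0 hc1 (half_pos hη),
      hξ.eventually_exp_le hc0 hc1 (half_pos hη), hlogn.eventually_gt_atTop 0] with n h1 h2 hT
    have hpos : 0 < P n := (Real.exp_pos _).trans_le h2
    have h1' : Real.log (P n) ≤ -(SimpleWalk.rate c - η / 2) * Real.log n :=
      (Real.log_le_iff_le_exp hpos).2 h1
    have h2' : -(SimpleWalk.rate c + η / 2) * Real.log n ≤ Real.log (P n) :=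
      (Real.le_log_iff_exp_le hpos).2 h2
    have h3 : -Real.log (P n) / Real.log n ≤ SimpleWalk.rate c + η / 2 := by
      rw [div_le_iff₀ hT]; linarith
    have h4 : SimpleWalk.rate c - η / 2 ≤ -Real.log (P n) / Real.log n := by
      rw [le_div_iff₀ hT]; linarith
    rw [Real.dist_eq, sub_zero, abs_lt]
    constructor <;> linarith
  · filter_upwards [hξ.eventually_exp_le hc0 hc1 one_pos, hlogn.eventually_gt_atTop 0]
      with n h2 hT
    have hpos : 0 < P n := (Real.exp_pos _).trans_le h2
    rw [show -(SimpleWalk.rate c + (-Real.log (P n) / Real.log n - SimpleWalk.rate c)) *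
      Real.log n = Real.log (P n) by field_simp; ring, Real.exp_log hpos]
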